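/- Let $p$ be a prime and let $G$ be a finite $p$-group that has a cyclic maximal subgroup. For a word $w$ in $k \ge 0$ variables, that is, an element of the free group $F_k = \langle x_1,\dots,x_k\rangle$, let $w : G^k \to G$, $(g_1,\dots,g_k)\mapsto w(g_1,\dots,g_k)$, be the word map obtained by substituting $g_i$ for $x_i$, let $G_w \subseteq G$ be its image, and for $g \in G$ put $$P_{w,G}(g) = \frac{\bigl|\{(g_1,\dots,g_k)\in G^k : w(g_1,\dots,g_k)=g\}\bigr|}{|G|^k}.$$ Then for every $k \ge 0$, every word $w \in F_k$ and every $g\in G_w$, $$P_{w,G}(g) \ge \frac{1}{|G|}.$$ -/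

import Mathlib

/-- The word map `G ^ k → G` of a word `w` in `k` variables (an element of the free group on
`x₀, …, x_{k-1}`): substitute `g i` for the `i`-th variable. -/
def wordMap (G : Type*) [Group G] {k : ℕ} (w : FreeGroup (Fin k)) (g : Fin k → G) : G :=
  FreeGroup.lift g w

/-- The set `G_w` of word values of `w` in `G`, i.e. the image of the word map. -/
def wordValues (G : Type*) [Group G] {k : ℕ} (w : FreeGroup (Fin k)) : Set G :=
  Set.range (wordMap G w)

/-- The fibre of `g` in `G ^ k` under the word map of `w`. -/
def wordFibre (G : Type*) [Group G] {k : ℕ} (w : FreeGroup (Fin k)) (g : G) : Set (Fin k → G) :=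
  {x | wordMap G w x = g}

/-- The probability `P_{w,G}(g) = |{x ∈ G ^ k : w(x) = g}| / |G| ^ k` (for a finite group `G`). -/
noncomputable def wordProb (G : Type*) [Group G] {k : ℕ} (w : FreeGroup (Fin k)) (g : G) : ℚ :=
  ((wordFibre G w g).ncard : ℚ) / (Nat.card G : ℚ) ^ k

/-!
Let `M` be the cyclic maximal subgroup, `|M| = p ^ m`, fix `b ∉ M`, and write every element of `G`
as `n * b ^ i` with `n ∈ M` and `0 ≤ i < p`. It has to be shown that each nonempty fibre of the word
map has at least `|G| ^ (k - 1)` elements.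

If `p` does not divide the exponent sum of `w` in some variable, then `w` is a bijective function of
that variable for all fixed values of the others
(`FreeGroup.lift_injective_of_not_dvd_exponentSum`), so all fibres have exactly `|G| ^ (k - 1)`
elements. If `G` is abelian, the word map is a homomorphism and its fibres are cosets of the kernel.

Otherwise `b` acts on `M` by a power map `x ↦ x ^ l` with `l ≡ 1 [ZMOD p]`, and `b ^ p` is a `p`-th
power in `M` (else `b` generates `G`). Fox calculus (`FreeGroup.exists_lift_mul_eq`) gives integer
polynomials `D j` such that
`w (n₁ b ^ i₁, …, nₖ b ^ iₖ) = (∏ j, n j ^ D j (l ^ i₁, …, l ^ iₖ)) * w (b ^ i₁, …, b ^ iₖ)`.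
So on each product of cosets `w` is a translate of a homomorphism `M ^ k → M`. Let `p ^ s` be the
largest power of `p` dividing all the numbers `D j (l ^ i₁, …, l ^ iₖ)`, and suppose `s < m`; if
`s ≥ m` the word map is trivial. All word values lie in the subgroup `M ^ (p ^ s)`; for the factors
`w (b ^ i₁, …, b ^ iₖ)` this uses that `b ^ p` is a `p`-th power in `M`. Conversely, for every `i`
at which some `D j` is not divisible by `p ^ (s + 1)`, the homomorphism has image `M ^ (p ^ s)`, so
each word value is attained `p ^ s * |M| ^ (k - 1)` times on the corresponding product of cosets.

As the numbers `l ^ i` are all congruent modulo `p`, a polynomial in them that is not identically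
zero modulo `p ^ (s + 1)` is nonzero at no fewer than `p ^ (k - s)` of the `p ^ k` points
(`card_pow_le_mul_card_not_dvd`, which is analogous to the minimum distance of Reed–Muller codes).
Hence every word value is attained at least
`p ^ k * |M| ^ (k - 1) = p * |G| ^ (k - 1)` times in this case.
-/

/-! ### Nonvanishing of polynomials on grids of congruent points -/

open MvPolynomial in
/-- If the values `t c` are all congruent modulo `π`, a polynomial that does not vanish modulo
`π ^ (s + 1)` on the whole grid is nonzero there at a proportion of at least `|ι| ^ (-s)` of the
points. Two slices in the first variable differ by `π` times a polynomial, so if some slice vanishes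
modulo `π ^ (s + 1)`, any other slice is congruent to `π` times a polynomial, which has to be nonzero
modulo `π ^ s` if the slice is nonzero. -/
theorem card_pow_le_mul_card_not_dvd {R ι : Type*} [CommRing R] [IsDomain R] [Fintype ι]
    [Nonempty ι] {π : R} (hπ : π ≠ 0) (t : ι → R) (ht : ∀ c c', π ∣ t c - t c') {k : ℕ} (s : ℕ)
    (P : MvPolynomial (Fin k) R) (h : ∃ i : Fin k → ι, ¬ π ^ (s + 1) ∣ eval (t ∘ i) P) :
    Nat.card ι ^ k ≤
      Nat.card ι ^ s * Nat.card {i : Fin k → ι // ¬ π ^ (s + 1) ∣ eval (t ∘ i) P} := by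
  induction k generalizing s with
  | zero =>
    obtain ⟨i, hi⟩ := h
    have : Nonempty {i : Fin 0 → ι // ¬ π ^ (s + 1) ∣ eval (t ∘ i) P} := ⟨⟨i, hi⟩⟩
    rw [pow_zero]
    exact Nat.mul_pos (pow_pos Nat.card_pos _) Nat.card_pos
  | succ k ih =>
    set Q : ι → MvPolynomial (Fin k) R := fun c => (finSuccEquiv R k P).eval (C (t c)) with hQ
    have hslice (c : ι) (i : Fin k → ι) :
        eval (t ∘ (Fin.cons c i : Fin (k + 1) → ι)) P = eval (t ∘ i) (Q c) := by
      have : t ∘ (Fin.cons c i : Fin (k + 1) → ι) = Fin.cons (t c) (t ∘ i) := by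
        ext j; refine Fin.cases ?_ (fun j => ?_) j <;> simp
      rw [this, eval_eq_eval_mv_eval', Polynomial.eval_map, hQ]
      simp only [Polynomial.eval, Polynomial.hom_eval₂]
      simp
    have hcard : Nat.card {i : Fin (k + 1) → ι // ¬ π ^ (s + 1) ∣ eval (t ∘ i) P} =
        ∑ c, Nat.card {i : Fin k → ι // ¬ π ^ (s + 1) ∣ eval (t ∘ i) (Q c)} := by
      rw [← Nat.card_sigma]
      refine Nat.card_congr ?_
      refine ((Fin.consEquiv fun _ => ι).symm.subtypeEquiv (q := fun x : ι × (Fin k → ι) =>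
        ¬ π ^ (s + 1) ∣ eval (t ∘ x.2) (Q x.1)) fun i => ?_).trans
        (Equiv.subtypeProdEquivSigmaSubtype fun c i => ¬ π ^ (s + 1) ∣ eval (t ∘ i) (Q c))
      rw [← hslice]
      simp [Fin.consEquiv]
    rw [hcard]
    -- `Q c` is the slice of `P` at first coordinate `c`; either no slice vanishes on the grid, or
    -- a vanishing slice `Q c'` makes the nonvanishing one a multiple of `π`.
    by_cases hall : ∀ c, ∃ i, ¬ π ^ (s + 1) ∣ eval (t ∘ i) (Q c)
    · calc Nat.card ι ^ (k + 1) = ∑ _c : ι, Nat.card ι ^ k := by simp [pow_succ']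
        _ ≤ ∑ c, Nat.card ι ^ s *
            Nat.card {i : Fin k → ι // ¬ π ^ (s + 1) ∣ eval (t ∘ i) (Q c)} :=
          Finset.sum_le_sum fun c _ => ih s (Q c) (hall c)
        _ = _ := by rw [Finset.mul_sum]
    · push Not at hall
      obtain ⟨c', hc'⟩ := hall
      obtain ⟨i, hi⟩ := h
      obtain ⟨H, hH⟩ : C π ∣ Q (i 0) - Q c' := by
        refine dvd_trans ?_ (Polynomial.sub_dvd_eval_sub _ _ _)
        rw [← C_sub]
        exact map_dvd C (ht _ _)
      have hdvd (x : Fin k → ι) :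
          π ^ (s + 1) ∣ eval (t ∘ x) (Q (i 0)) ↔ π ^ s ∣ eval (t ∘ x) H := by
        rw [eq_add_of_sub_eq hH, map_add, dvd_add_left (hc' x), map_mul, eval_C, pow_succ',
          mul_dvd_mul_iff_left hπ]
      have hi' : ¬ π ^ s ∣ eval (t ∘ Fin.tail i) H := by
        rwa [← hdvd, ← hslice, Fin.cons_self_tail]
      cases s with
      | zero => simp at hi'
      | succ s =>
        calc Nat.card ι ^ (k + 1) ≤ Nat.card ι * (Nat.card ι ^ s *
              Nat.card {i : Fin k → ι // ¬ π ^ (s + 1) ∣ eval (t ∘ i) H}) := by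
              rw [pow_succ']; exact Nat.mul_le_mul_left _ (ih s H ⟨_, hi'⟩)
          _ = Nat.card ι ^ (s + 1) *
              Nat.card {x : Fin k → ι // ¬ π ^ (s + 1 + 1) ∣ eval (t ∘ x) (Q (i 0))} := by
              simp only [hdvd]; ring
          _ ≤ _ := Nat.mul_le_mul_left _ (Finset.single_le_sum
              (f := fun c => Nat.card {x : Fin k → ι // ¬ π ^ (s + 1 + 1) ∣ eval (t ∘ x) (Q c)})
              (fun _ _ => Nat.zero_le _) (Finset.mem_univ (i 0)))

/-! ### Word maps and exponent sums -/

theorem MonoidHom.card_fiber_mul_card_range {A B : Type*} [Group A] [Group B] (f : A →* B)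
    {y : B} (hy : y ∈ f.range) :
    Nat.card {a // f a = y} * Nat.card f.range = Nat.card A := by
  obtain ⟨x, rfl⟩ := hy
  have : Nat.card {a // f a = f x} = Nat.card f.ker := by
    refine Nat.card_congr ((Equiv.mulLeft x⁻¹).subtypeEquiv fun a => ?_)
    rw [Equiv.coe_mulLeft, MonoidHom.mem_ker, map_mul, map_inv, inv_mul_eq_one, eq_comm]
  rw [this, ← Subgroup.index_ker, Subgroup.card_mul_index]

namespace FreeGroup

variable {k : ℕ}

/-- The sum of the exponents with which the `j`-th variable occurs in `w`: the image of `w` under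
the homomorphism to `ℤ` that sends the `j`-th variable to `1` and the others to `0`. -/
def exponentSum (j : Fin k) (w : FreeGroup (Fin k)) : ℤ :=
  Multiplicative.toAdd (lift (Pi.mulSingle j (Multiplicative.ofAdd 1)) w)

theorem lift_eq_prod_zpow_exponentSum {A : Type*} [CommGroup A] (z : Fin k → A)
    (w : FreeGroup (Fin k)) : lift z w = ∏ j, z j ^ exponentSum j w := by
  induction w using FreeGroup.induction_on with
  | C1 => simp [exponentSum]
  | of x =>
    rw [Finset.prod_eq_single x]
    · simp [exponentSum]
    · intro j _ hj
      simp [exponentSum, Pi.mulSingle_eq_of_ne hj.symm]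
    · simp
  | inv_of x ih =>
    rw [_root_.map_inv, ih, ← Finset.prod_inv_distrib]
    simp [exponentSum]
  | mul v w hv hw =>
    rw [_root_.map_mul, hv, hw, ← Finset.prod_mul_distrib]
    simp [exponentSum, zpow_add]

theorem lift_mul_of_central {A G : Type*} [Group G] [CommGroup A] (ι : A →* G)
    (hι : ∀ a g, Commute (ι a) g) (z : Fin k → A) (x : Fin k → G) (w : FreeGroup (Fin k)) :
    lift (fun j => ι (z j) * x j) w = ι (lift z w) * lift x w := by
  induction w using FreeGroup.induction_on with
  | C1 => simp
  | of x => simp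
  | inv_of x ih =>
    rw [_root_.map_inv, ih, mul_inv_rev, _root_.map_inv, _root_.map_inv, _root_.map_inv]
    exact ((hι _ _).inv_inv.eq).symm
  | mul v w hv hw =>
    simp only [_root_.map_mul, hv, hw]
    have := (hι (lift z w) (lift x v)).eq
    simp only [mul_assoc]
    rw [← mul_assoc (lift x v), ← this, mul_assoc]

/-- In a `p`-group, a word whose exponent sum in the `j`-th variable is prime to `p` is an injective
function of that variable. By induction along central quotients, two arguments with equal values
differ by a central `z`, which changes the value by `z ^ exponentSum j w`. -/
theorem lift_injective_of_not_dvd_exponentSum {p : ℕ} (hp : p.Prime) {G : Type*} [Group G]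
    [Group.IsNilpotent G] (hG : IsPGroup p G) {w : FreeGroup (Fin k)} {j : Fin k}
    (hj : ¬ (p : ℤ) ∣ exponentSum j w) : ∀ x y : Fin k → G, (∀ i ≠ j, x i = y i) →
      lift x w = lift y w → x j = y j := by
  refine Group.nilpotent_center_quotient_ind (P := fun G _ _ => IsPGroup p G → ∀ x y : Fin k → G,
    (∀ i ≠ j, x i = y i) → lift x w = lift y w → x j = y j) G ?_ ?_ hG
  · exact fun G _ _ _ _ _ _ _ => Subsingleton.elim _ _
  · intro G _ _ ih hG x y hxy h
    have hq (u : Fin k → G) : lift (fun i => (u i : G ⧸ Subgroup.center G)) w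
        = (lift u w : G) := by
      have : lift (fun i => (u i : G ⧸ Subgroup.center G)) =
          (QuotientGroup.mk' (Subgroup.center G)).comp (lift u) := by ext; simp
      rw [this]; rfl
    have key := ih (hG.to_quotient _) (fun i => (x i : G ⧸ Subgroup.center G))
      (fun i => (y i : G ⧸ Subgroup.center G)) (fun i hi => by rw [hxy i hi])
      (by rw [hq, hq, h])
    rw [QuotientGroup.eq] at key
    obtain ⟨z, hz⟩ : ∃ z, z = (x j)⁻¹ * y j := ⟨_, rfl⟩
    -- The central subgroup generated by `z`, presented as the image of `ℤ`, so that the exponent sum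
    -- appears by its definition.
    have hc (a : Multiplicative ℤ) (g : G) : Commute (zpowersHom G z a) g := by
      rw [zpowersHom_apply]
      exact Commute.zpow_left (Subgroup.mem_center_iff.1 (hz ▸ key) g).symm _
    have hy : y = fun i => zpowersHom G z
        ((Pi.mulSingle j (Multiplicative.ofAdd 1) : Fin k → Multiplicative ℤ) i) * x i := by
      ext i
      by_cases hi : i = j
      · subst hi
        rw [Pi.mulSingle_eq_same, (hc _ _).eq]
        simp [hz]
      · simp [Pi.mulSingle_eq_of_ne hi, hxy i hi]
    rw [hy, lift_mul_of_central _ hc, right_eq_mul, zpowersHom_apply] at h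
    change z ^ exponentSum j w = 1 at h
    obtain ⟨n, hn⟩ := hG z
    have hcop : IsCoprime ((p : ℤ) ^ n) (exponentSum j w) :=
      IsCoprime.pow_left ((Nat.prime_iff_prime_int.1 hp).coprime_iff_not_dvd.2 hj)
    obtain ⟨u, v, huv⟩ := hcop
    have hn' : z ^ ((p : ℤ) ^ n) = 1 := by exact_mod_cast hn
    have : z = 1 := by
      rw [← zpow_one z, ← huv, zpow_add, mul_comm u, mul_comm v, zpow_mul, zpow_mul, h, hn']
      simp
    rw [this] at hz
    exact inv_mul_eq_one.1 hz.symm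

/-! ### Fox calculus -/

open MvPolynomial in
/-- Let each `u j` act on the abelian normal subgroup `ι A` as a power map with exponent `t j`,
with inverse the exponent `t j ^ r`. Then `lift u w` acts by an exponent `T`, and multiplying the
arguments `u j` by elements `n j` of `ι A` multiplies the value by `∏ j, n j ^ D j`, where `T` and
the Fox derivatives `D j` are integer polynomials in `t` that depend on `w` and `r` only. The
exponent `r` replaces the negative powers of `t j` in the usual Fox derivatives. -/
theorem exists_lift_mul_eq {A G : Type*} [Group G] [CommGroup A] (ι : A →* G) (r : ℕ)
    (w : FreeGroup (Fin k)) :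
    ∃ (T : MvPolynomial (Fin k) ℤ) (D : Fin k → MvPolynomial (Fin k) ℤ),
      ∀ (u : Fin k → G) (t : Fin k → ℤ),
        (∀ j a, u j * ι a * (u j)⁻¹ = ι (a ^ t j)) →
        (∀ j a, (u j)⁻¹ * ι a * u j = ι (a ^ t j ^ r)) →
        (∀ a, lift u w * ι a * (lift u w)⁻¹ = ι (a ^ eval t T)) ∧
        ∀ n : Fin k → A, lift (fun j => ι (n j) * u j) w =
          ι (∏ j, n j ^ eval t (D j)) * lift u w := by
  induction w using FreeGroup.induction_on with
  | C1 => exact ⟨1, 0, by simp⟩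
  | of x =>
    refine ⟨X x, fun j => if j = x then 1 else 0, fun u t h h' => ⟨by simpa using h x, fun n => ?_⟩⟩
    rw [Finset.prod_eq_single x] <;> simp +contextual
  | inv_of x _ =>
    refine ⟨X x ^ r, fun j => if j = x then -X x ^ r else 0, fun u t h h' =>
      ⟨by simpa using h' x, fun n => ?_⟩⟩
    rw [Finset.prod_eq_single x]
    · have := h' x (n x)⁻¹
      simp only [_root_.map_inv, lift_apply_of, mul_inv_rev, if_true, map_neg, map_pow, eval_X,
        zpow_neg, inv_zpow] at this ⊢
      rw [← this]; group
    · simp +contextual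
    · simp
  | mul v w hv hw =>
    obtain ⟨T, D, h1⟩ := hv
    obtain ⟨T', D', h2⟩ := hw
    refine ⟨T * T', fun j => D j + T * D' j, fun u t h h' => ⟨fun a => ?_, fun n => ?_⟩⟩
    · have e1 := (h1 u t h h').1 (a ^ eval t T')
      rw [← (h2 u t h h').1 a, ← zpow_mul, mul_comm, ← _root_.map_mul] at e1
      rw [← e1, _root_.map_mul]; group
    · have e1 := (h1 u t h h').1 (∏ j, n j ^ eval t (D' j))
      rw [_root_.map_mul, (h1 u t h h').2 n, (h2 u t h h').2 n, _root_.map_mul]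
      have e2 : ∏ j, n j ^ eval t (D j + T * D' j) =
          (∏ j, n j ^ eval t (D j)) * (∏ j, n j ^ eval t (D' j)) ^ eval t T := by
        rw [← Finset.prod_zpow, ← Finset.prod_mul_distrib]
        refine Finset.prod_congr rfl fun j _ => ?_
        rw [← zpow_mul, ← zpow_add, map_add, _root_.map_mul, mul_comm (eval t T)]
      rw [e2, _root_.map_mul ι, ← e1]; group

/-! ### Lower bounds for the fibres -/

theorem card_pow_le_of_not_dvd_exponentSum {p : ℕ} (hp : p.Prime) {G : Type*} [Group G]
    [Finite G] (hG : IsPGroup p G) {w : FreeGroup (Fin k)} {j : Fin k}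
    (hj : ¬ (p : ℤ) ∣ exponentSum j w) (g : G) :
    Nat.card G ^ k ≤ Nat.card {x : Fin k → G // lift x w = g} * Nat.card G := by
  have := Fact.mk hp
  have := hG.isNilpotent
  -- Replacing the `j`-th argument by the word value permutes `G ^ k`, and carries the fibre over
  -- `g` to the tuples whose `j`-th entry is `g`.
  have hinj : Function.Injective fun x : Fin k → G => Function.update x j (lift x w) := by
    intro x y hxy
    have hne (i) (hi : i ≠ j) : x i = y i := by simpa [hi] using congrFun hxy i
    ext i
    by_cases hi : i = j
    · subst hi
      exact lift_injective_of_not_dvd_exponentSum hp hG hj x y hne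
        (by simpa using congrFun hxy i)
    · exact hne i hi
  have hcard : Nat.card {x : Fin k → G // lift x w = g} = Nat.card {y : Fin k → G // y j = g} :=
    Nat.card_congr ((Equiv.ofBijective _ (Finite.injective_iff_bijective.1 hinj)).subtypeEquiv
      fun x => by simp)
  have hrange : (Pi.evalMonoidHom (fun _ : Fin k => G) j).range = ⊤ :=
    MonoidHom.range_eq_top.2 (Function.surjective_eval j)
  have key := (Pi.evalMonoidHom (fun _ : Fin k => G) j).card_fiber_mul_card_range
    (y := g) (by simp [hrange])
  rw [hrange, Subgroup.card_top] at key
  rw [hcard]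
  simpa [Nat.card_fun] using key.ge

theorem card_pow_le_of_commGroup {A : Type*} [CommGroup A] [Finite A] {w : FreeGroup (Fin k)}
    {g : A} (hg : ∃ x, lift x w = g) :
    Nat.card A ^ k ≤ Nat.card {x : Fin k → A // lift x w = g} * Nat.card A := by
  let f : (Fin k → A) →* A :=
    { toFun := fun x => lift x w
      map_one' := by simp [lift_eq_prod_zpow_exponentSum]
      map_mul' := fun x y => lift_mul_of_central (.id A) (fun a b => Commute.all a b) x y w }
  have := f.card_fiber_mul_card_range (y := g) hg
  calc Nat.card A ^ k = Nat.card (Fin k → A) := by simp [Nat.card_fun]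
    _ = Nat.card {x : Fin k → A // lift x w = g} * Nat.card f.range := this.symm
    _ ≤ _ := Nat.mul_le_mul_left _ (Subgroup.card_le_card_group _)

open MvPolynomial in
/-- The fibre bound for words whose exponent sums are all divisible by `p`, in a group `G` that is
the disjoint union of the cosets `ι A * b ^ i`, `0 ≤ i < p`, with `A` cyclic of order `p ^ m`. The
action of `b` on `ι A` is trivial modulo `p`, and `b ^ p` is a `p`-th power in `ι A`. -/
theorem card_pow_le_of_dvd_exponentSum {p : ℕ} (hp : p.Prime) {A G : Type*} [Group G] [Finite G]
    [CommGroup A] [Finite A] (ι : A →* G) (hι : Function.Injective ι) {a : A}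
    (ha : ∀ x, x ∈ Subgroup.zpowers a) {m : ℕ} (hm : Nat.card A = p ^ m) {b : G} {l c : ℤ}
    (hl : ∀ x, b * ι x * b⁻¹ = ι (x ^ l)) (hlp : (p : ℤ) ∣ l - 1)
    (hbp : b ^ p = ι (a ^ (p * c)))
    (hbij : Function.Bijective fun q : A × Fin p => ι q.1 * b ^ (q.2 : ℕ))
    {w : FreeGroup (Fin k)} (hw : ∀ j, (p : ℤ) ∣ exponentSum j w)
    {g : G} (hg : ∃ x, lift x w = g) :
    Nat.card G ^ k ≤ Nat.card {x : Fin k → G // lift x w = g} * Nat.card G := by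
  have hp0 : (p : ℤ) ≠ 0 := by exact_mod_cast hp.ne_zero
  have hord : orderOf a = p ^ m := by rw [orderOf_eq_card_of_forall_mem_zpowers ha, hm]
  have hconj (i : ℕ) (x : A) : b ^ i * ι x * (b ^ i)⁻¹ = ι (x ^ l ^ i) := by
    induction i generalizing x with
    | zero => simp
    | succ i ih => rw [pow_succ l, zpow_mul, ← hl, ← ih, pow_succ' b]; group
  have hlpow (i : ℕ) (x : A) : x ^ (l ^ p) ^ i = x := by
    have h1 (x : A) : x ^ l ^ p = x := by
      refine hι ?_
      rw [← hconj, hbp, ← _root_.map_mul, mul_comm, _root_.map_mul, mul_inv_cancel_right]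
    induction i with
    | zero => simp
    | succ i ih => rw [pow_succ, zpow_mul, ih, h1]
  have hconj' (i : ℕ) (x : A) : (b ^ i)⁻¹ * ι x * b ^ i = ι (x ^ (l ^ i) ^ (p - 1)) := by
    have h1 : ι x = b ^ i * ι (x ^ (l ^ i) ^ (p - 1)) * (b ^ i)⁻¹ := by
      rw [hconj, ← zpow_mul, ← pow_succ, Nat.sub_add_cancel hp.one_le, ← pow_mul, mul_comm,
        pow_mul, hlpow]
    rw [h1]; group
  obtain ⟨T, D, hD⟩ := exists_lift_mul_eq ι (p - 1) w
  -- `E i j` is the `j`-th Fox derivative of `w` on the product of the cosets `ι A * b ^ (i j)`.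
  let t : Fin p → ℤ := fun i => l ^ (i : ℕ)
  let E : (Fin k → Fin p) → Fin k → ℤ := fun i j => eval (t ∘ i) (D j)
  have hE (i : Fin k → Fin p) (n : Fin k → A) :
      lift (fun j => ι (n j) * b ^ (i j : ℕ)) w =
        ι (∏ j, n j ^ E i j) * b ^ (∑ j, (i j : ℤ) * exponentSum j w) := by
    rw [(hD (fun j => b ^ (i j : ℕ)) (t ∘ i) (fun j => hconj (i j)) (fun j => hconj' (i j))).2 n]
    congr 1
    have : lift (fun j => b ^ (i j : ℕ)) = (zpowersHom G b).comp
        (lift fun j => Multiplicative.ofAdd (i j : ℤ)) := by ext; simp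
    rw [this, MonoidHom.comp_apply, lift_eq_prod_zpow_exponentSum, zpowersHom_apply, toAdd_prod]
    simp [mul_comm]
  -- At `i = 0` all the arguments lie in `ι A`, so there `E i j` is the exponent sum modulo `p ^ m`.
  have hDd (j : Fin k) {s : ℕ} (hs : s ≤ m) (h : ∀ i, (p : ℤ) ^ s ∣ E i j) :
      (p : ℤ) ^ s ∣ exponentSum j w := by
    have h1 := hE (fun _ => ⟨0, hp.pos⟩) (Pi.mulSingle j a)
    have h2 : lift (fun i => ι ((Pi.mulSingle j a : Fin k → A) i)) = ι.comp
        (lift (Pi.mulSingle j a : Fin k → A)) := by ext; simp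
    simp only [pow_zero, mul_one, Nat.cast_zero, zero_mul, Finset.sum_const_zero, zpow_zero, h2,
      MonoidHom.comp_apply, lift_eq_prod_zpow_exponentSum] at h1
    have h3 := hι h1
    rw [Finset.prod_eq_single j (fun i _ hi => by simp [Pi.mulSingle_eq_of_ne hi]) (by simp),
      Finset.prod_eq_single j (fun i _ hi => by simp [Pi.mulSingle_eq_of_ne hi]) (by simp),
      Pi.mulSingle_eq_same, zpow_eq_zpow_iff_modEq, hord, Int.modEq_iff_dvd] at h3
    have h4 : (p : ℤ) ^ s ∣ E (fun _ => ⟨0, hp.pos⟩) j - exponentSum j w :=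
      (pow_dvd_pow _ hs).trans (by exact_mod_cast h3)
    exact (dvd_sub_right (h _)).1 h4
  -- For `s = 0` the exponent of `b` is divisible by `p` by `hw`; for `s > 0` it is a multiple of
  -- `p ^ s`, and `b ^ (p ^ s)` is the `p ^ (s - 1)`-th power of the `p`-th power `b ^ p`.
  have hN {s : ℕ} (hs : s ≤ m) (h : ∀ i j, (p : ℤ) ^ s ∣ E i j) (i : Fin k → Fin p) :
      ∃ y ∈ Subgroup.zpowers (a ^ p ^ s), b ^ (∑ j, (i j : ℤ) * exponentSum j w) = ι y := by
    cases s with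
    | zero =>
      obtain ⟨e, he⟩ : (p : ℤ) ∣ ∑ j, (i j : ℤ) * exponentSum j w :=
        Finset.dvd_sum fun j _ => (hw j).mul_left _
      exact ⟨(a ^ (p * c)) ^ e, by simpa using ha _, by rw [he, zpow_mul, map_zpow, ← hbp]; simp⟩
    | succ s =>
      obtain ⟨e, he⟩ : (p : ℤ) ^ (s + 1) ∣ ∑ j, (i j : ℤ) * exponentSum j w :=
        Finset.dvd_sum fun j _ => (hDd j hs fun i => h i j).mul_left _
      refine ⟨(a ^ p ^ (s + 1)) ^ (c * e), Subgroup.zpow_mem_zpowers _ _, ?_⟩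
      have : (p : ℤ) ^ (s + 1) * e = p * (p ^ s * e) := by ring
      rw [he, this, zpow_mul, zpow_natCast, hbp, ← map_zpow, ← zpow_mul, ← zpow_natCast,
        ← zpow_mul]
      congr 2
      push_cast; ring
  have hprod {s : ℕ} (h : ∀ i j, (p : ℤ) ^ s ∣ E i j) (i : Fin k → Fin p) (n : Fin k → A) :
      ∏ j, n j ^ E i j ∈ Subgroup.zpowers (a ^ p ^ s) := by
    refine Subgroup.prod_mem _ fun j _ => ?_
    obtain ⟨e, he⟩ := ha (n j)
    obtain ⟨f, hf⟩ := h i j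
    refine ⟨e * f, ?_⟩
    simp only at he ⊢
    rw [hf, ← he, ← zpow_natCast, ← zpow_mul, ← zpow_mul]
    congr 1
    push_cast; ring
  have hsurj (x : Fin k → G) : ∃ (i : Fin k → Fin p) (n : Fin k → A),
      x = fun j => ι (n j) * b ^ (i j : ℕ) := by
    choose q hq using fun j => hbij.2 (x j)
    exact ⟨fun j => (q j).2, fun j => (q j).1, funext fun j => (hq j).symm⟩
  have hval {s : ℕ} (hs : s ≤ m) (h : ∀ i j, (p : ℤ) ^ s ∣ E i j) (x : Fin k → G) :
      ∃ y ∈ Subgroup.zpowers (a ^ p ^ s), lift x w = ι y := by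
    obtain ⟨i, n, rfl⟩ := hsurj x
    obtain ⟨y, hy, hy'⟩ := hN hs h i
    exact ⟨_, mul_mem (hprod h i n) hy, by rw [hE, hy', _root_.map_mul]⟩
  have hGcard : Nat.card G = p ^ m * p := by
    rw [← Nat.card_congr (Equiv.ofBijective _ hbij), Nat.card_prod, hm, Nat.card_fin]
  obtain ⟨x₀, rfl⟩ := hg
  by_cases htriv : ∀ i j, (p : ℤ) ^ m ∣ E i j
  · have h1 (x : Fin k → G) : lift x w = 1 := by
      obtain ⟨y, hy, hxy⟩ := hval le_rfl htriv x
      rw [← hord, pow_orderOf_eq_one, Subgroup.zpowers_one_eq_bot, Subgroup.mem_bot] at hy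
      rw [hxy, hy, _root_.map_one]
    have : Nat.card {x : Fin k → G // lift x w = lift x₀ w} = Nat.card G ^ k := by
      simp [h1, Nat.card_fun]
    rw [this]
    exact Nat.le_mul_of_pos_right _ Nat.card_pos
  · push Not at htriv
    classical
    -- The largest `s` such that `p ^ s` divides all the derivatives is one less than the least
    -- exponent for which divisibility fails, which is positive.
    have hex : ∃ s, ∃ i j, ¬ (p : ℤ) ^ s ∣ E i j := ⟨m, htriv⟩
    obtain ⟨s, hs⟩ : ∃ s, Nat.find hex = s + 1 := by
      refine Nat.exists_eq_succ_of_ne_zero fun h0 => ?_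
      have := Nat.find_spec hex
      simp [h0] at this
    have hsm : s < m := by have := Nat.find_min' hex htriv; omega
    have hdvd (i j) : (p : ℤ) ^ s ∣ E i j := by
      have := Nat.find_min hex (m := s) (by omega)
      push Not at this
      exact this i j
    have hspec := Nat.find_spec hex
    rw [hs] at hspec
    obtain ⟨i₀, j₀, h₀⟩ := hspec
    have hlp' (i : ℕ) : (p : ℤ) ∣ l ^ i - 1 := hlp.trans (sub_one_dvd_pow_sub_one l i)
    have := Fact.mk hp
    have hsupp := card_pow_le_mul_card_not_dvd hp0 t
      (fun i i' => by simpa [t] using dvd_sub (hlp' i) (hlp' i')) s (D j₀) ⟨i₀, h₀⟩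
    rw [Nat.card_fin] at hsupp
    obtain ⟨y, hy, hxy⟩ := hval hsm.le hdvd x₀
    rw [hxy]
    set S := {i : Fin k → Fin p // ¬ (p : ℤ) ^ (s + 1) ∣ E i j₀}
    have hzcard : Nat.card (Subgroup.zpowers (a ^ p ^ s)) * p ^ s = p ^ m := by
      rw [Nat.card_zpowers, orderOf_pow_of_dvd (pow_ne_zero _ hp.ne_zero)
        (hord ▸ pow_dvd_pow p hsm.le), hord, Nat.div_mul_cancel (pow_dvd_pow p hsm.le)]
    -- On the coset product of `i ∈ S`, the word map is a translate of a homomorphism `φ` with range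
    -- `⟨a ^ p ^ s⟩`; since `E i j₀` is `p ^ s` times a number prime to `p`, the `j₀`-th variable
    -- alone gives all of it.
    have hfib (i : S) : Nat.card {n : Fin k → A // lift (fun j => ι (n j) * b ^ (i.1 j : ℕ)) w
        = ι y} * Nat.card (Subgroup.zpowers (a ^ p ^ s)) = (p ^ m) ^ k := by
      obtain ⟨z, hz, hz'⟩ := hN hsm.le hdvd i
      let φ : (Fin k → A) →* A :=
        { toFun := fun n => ∏ j, n j ^ E i j
          map_one' := by simp
          map_mul' := fun n n' => by simp [mul_zpow, Finset.prod_mul_distrib] }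
      have hrange : φ.range = Subgroup.zpowers (a ^ p ^ s) := by
        refine le_antisymm (by rintro _ ⟨n, rfl⟩; exact hprod hdvd i n) ?_
        rw [Subgroup.zpowers_le]
        obtain ⟨v, hv⟩ := hdvd i j₀
        have hpv : ¬ (p : ℤ) ∣ v := fun ⟨v', hv'⟩ => i.2 ⟨v', by rw [hv, hv']; ring⟩
        obtain ⟨u, u', huv⟩ : IsCoprime ((p : ℤ) ^ m) v :=
          IsCoprime.pow_left ((Nat.prime_iff_prime_int.1 hp).coprime_iff_not_dvd.2 hpv)
        refine ⟨Pi.mulSingle j₀ (a ^ u'), ?_⟩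
        change ∏ j, (Pi.mulSingle j₀ (a ^ u') : Fin k → A) j ^ E i j = _
        rw [Finset.prod_eq_single j₀ (fun i _ hi => by simp [Pi.mulSingle_eq_of_ne hi]) (by simp),
          Pi.mulSingle_eq_same, ← zpow_mul, ← zpow_natCast, zpow_eq_zpow_iff_modEq, hord,
          Int.modEq_iff_dvd, hv]
        refine ⟨u * p ^ s, ?_⟩
        push_cast
        linear_combination (-(p : ℤ) ^ s) * huv
      have key := φ.card_fiber_mul_card_range (y := y * z⁻¹)
        (hrange ▸ mul_mem hy (inv_mem hz))
      rw [hrange, Nat.card_fun, Nat.card_fin, hm] at key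
      rw [← key]
      congr 1
      refine Nat.card_congr (Equiv.subtypeEquivRight fun n => ?_)
      rw [hE, hz', ← _root_.map_mul, hι.eq_iff, eq_mul_inv_iff_mul_eq]
      rfl
    have hle : Nat.card (Σ i : S, {n : Fin k → A //
        lift (fun j => ι (n j) * b ^ (i.1 j : ℕ)) w = ι y}) ≤
        Nat.card {x : Fin k → G // lift x w = ι y} := by
      refine Nat.card_le_card_of_injective (fun q => ⟨_, q.2.2⟩) ?_
      rintro ⟨⟨i, hi⟩, n, hn⟩ ⟨⟨i', hi'⟩, n', hn'⟩ h
      have h1 (j) := hbij.1 (a₁ := (n j, i j)) (a₂ := (n' j, i' j))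
        (congrFun (Subtype.ext_iff.1 h) j)
      simp only [Prod.mk.injEq] at h1
      obtain rfl : n = n' := funext fun j => (h1 j).1
      obtain rfl : i = i' := funext fun j => (h1 j).2
      rfl
    have hsum : Nat.card (Σ i : S, {n : Fin k → A //
        lift (fun j => ι (n j) * b ^ (i.1 j : ℕ)) w = ι y}) *
          Nat.card (Subgroup.zpowers (a ^ p ^ s)) = Nat.card S * (p ^ m) ^ k := by
      rw [Nat.card_sigma, Finset.sum_mul, Finset.sum_congr rfl fun i _ => hfib i]
      simp [Nat.card_eq_fintype_card]
    calc Nat.card G ^ k = p ^ k * (p ^ m) ^ k := by rw [hGcard]; ring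
      _ ≤ p ^ s * Nat.card S * (p ^ m) ^ k := Nat.mul_le_mul_right _ hsupp
      _ = Nat.card (Σ i : S, {n : Fin k → A //
          lift (fun j => ι (n j) * b ^ (i.1 j : ℕ)) w = ι y}) *
            (Nat.card (Subgroup.zpowers (a ^ p ^ s)) * p ^ s) := by
          rw [mul_assoc, ← hsum]; ring
      _ ≤ Nat.card {x : Fin k → G // lift x w = ι y} * p ^ m := by
          rw [hzcard]; exact Nat.mul_le_mul_right _ hle
      _ ≤ _ := by
          rw [hGcard]
          exact Nat.mul_le_mul_left _ (Nat.le_mul_of_pos_right _ hp.pos)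

end FreeGroup

/-! ### Groups with a cyclic maximal subgroup -/

section Coatom

variable {G : Type*} [Group G]

theorem Subgroup.normal_and_card_of_isCoatom {p : ℕ} [Fact p.Prime] [Finite G] (hG : IsPGroup p G)
    {M : Subgroup G} (hM : IsCoatom M) : M.Normal ∧ Nat.card G = Nat.card M * p := by
  have := hG.isNilpotent
  obtain ⟨n, hn⟩ := IsPGroup.iff_card.1 hG
  obtain ⟨m, hm⟩ := IsPGroup.iff_card.1 (hG.to_subgroup M)
  have hlt : m < n := by
    by_contra! h
    refine hM.1 (M.eq_top_of_le_card ?_)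
    rw [hn, hm]
    exact Nat.pow_le_pow_right (Fact.out : p.Prime).pos h
  obtain ⟨K, hK, hMK⟩ := Sylow.exists_subgroup_card_pow_succ (G := G) (p := p) (n := m)
    (hn ▸ pow_dvd_pow p hlt) hm
  have hne : K ≠ M := by
    rintro rfl
    exact absurd (Nat.pow_right_injective (Fact.out : p.Prime).two_le (hK.symm.trans hm)) (by simp)
  have htop : K = ⊤ := hM.2 K (lt_of_le_of_ne hMK hne.symm)
  refine ⟨Subgroup.NormalizerCondition.normal_of_coatom M Group.normalizerCondition_of_isNilpotent
    hM, ?_⟩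
  rw [hm, ← pow_succ, ← hK, htop, Subgroup.card_top]

theorem Subgroup.bijective_mul_pow {p : ℕ} [Fact p.Prime] [Finite G] {M : Subgroup G} [M.Normal]
    (hM : Nat.card G = Nat.card M * p) {b : G} (hb : b ∉ M) :
    b ^ p ∈ M ∧ Function.Bijective fun q : M × Fin p => (q.1 : G) * b ^ (q.2 : ℕ) := by
  have hcard : Nat.card (G ⧸ M) = p := by
    have h := M.card_eq_card_quotient_mul_card_subgroup
    rw [hM, mul_comm] at h
    exact (Nat.eq_of_mul_eq_mul_right Nat.card_pos h).symm
  have hbp : (b : G ⧸ M) ^ p = 1 := by rw [← hcard]; exact pow_card_eq_one'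
  have hord : orderOf (b : G ⧸ M) = p :=
    orderOf_eq_prime hbp (by rwa [Ne, QuotientGroup.eq_one_iff])
  refine ⟨(QuotientGroup.eq_one_iff _).1 (by simpa using hbp), ?_⟩
  rw [Nat.bijective_iff_injective_and_card]
  refine ⟨?_, by simp [hM]⟩
  rintro ⟨n, i⟩ ⟨n', i'⟩ h
  have hmk (n : M) (i : ℕ) : (((n : G) * b ^ i : G) : G ⧸ M) = (b : G ⧸ M) ^ i := by
    rw [QuotientGroup.mk_mul, (QuotientGroup.eq_one_iff _).2 n.2, one_mul, QuotientGroup.mk_pow]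
  have h1 := congrArg (QuotientGroup.mk : G → G ⧸ M) h
  simp only [hmk] at h1
  have h2 : (i : ℕ) = i' := pow_injOn_Iio_orderOf (by simp [hord]) (by simp [hord]) h1
  obtain rfl := Fin.ext h2
  simpa using h

theorem FreeGroup.card_pow_le_of_isCyclic_isCoatom {p : ℕ} (hp : p.Prime) [Finite G]
    (hG : IsPGroup p G) {M : Subgroup G} (hM : IsCoatom M) [IsCyclic M] {k : ℕ}
    (w : FreeGroup (Fin k)) {g : G} (hg : ∃ x, lift x w = g) :
    Nat.card G ^ k ≤ Nat.card {x : Fin k → G // lift x w = g} * Nat.card G := by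
  have := Fact.mk hp
  by_cases hw : ∃ j, ¬ (p : ℤ) ∣ exponentSum j w
  · obtain ⟨j, hj⟩ := hw
    exact card_pow_le_of_not_dvd_exponentSum hp hG hj g
  push Not at hw
  by_cases hcyc : IsCyclic G
  · let _ := IsCyclic.commGroup (α := G)
    exact card_pow_le_of_commGroup hg
  obtain ⟨hnorm, hcard⟩ := Subgroup.normal_and_card_of_isCoatom hG hM
  obtain ⟨b, hb⟩ : ∃ b, b ∉ M := by
    by_contra! h
    exact hM.1 ((Subgroup.eq_top_iff' M).2 h)
  obtain ⟨hbp, hbij⟩ := Subgroup.bijective_mul_pow hcard hb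
  obtain ⟨a, ha⟩ := IsCyclic.exists_generator (α := M)
  obtain ⟨m, hm⟩ := IsPGroup.iff_card.1 (hG.to_subgroup M)
  have hord : orderOf a = p ^ m := by rw [orderOf_eq_card_of_forall_mem_zpowers ha, hm]
  -- If `b` generated `a`, it would generate more than the maximal subgroup `M`, hence all of `G`.
  have hab : (a : G) ∉ Subgroup.zpowers b := by
    intro hab
    refine hcyc (isCyclic_iff_exists_zpowers_eq_top.2
      ⟨b, hM.2 _ (lt_of_le_of_ne ?_ ?_)⟩)
    · intro x hx
      obtain ⟨e, he⟩ := ha ⟨x, hx⟩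
      rw [← Subtype.coe_mk x hx, ← he]
      simpa using zpow_mem hab e
    · rintro rfl
      exact hb (Subgroup.mem_zpowers b)
  have hm0 : m ≠ 0 := by
    rintro rfl
    rw [pow_zero, orderOf_eq_one_iff] at hord
    exact hab (by simp [hord, one_mem])
  obtain ⟨e, he⟩ := ha ⟨b ^ p, hbp⟩
  have he' : (a : G) ^ e = b ^ p := by simpa using congrArg Subtype.val he
  -- If `p ∤ e`, then `b ^ p = a ^ e` is a generator of `M`.
  obtain ⟨c, rfl⟩ : (p : ℤ) ∣ e := by
    by_contra hpe
    obtain ⟨u, v, huv⟩ : IsCoprime ((p : ℤ) ^ m) e :=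
      IsCoprime.pow_left ((Nat.prime_iff_prime_int.1 hp).coprime_iff_not_dvd.2 hpe)
    have h1 : (a : G) ^ ((p : ℤ) ^ m) = 1 := by
      have : a ^ (p ^ m) = 1 := hord ▸ pow_orderOf_eq_one a
      exact_mod_cast congrArg Subtype.val this
    refine hab ⟨p * v, ?_⟩
    simp only
    rw [zpow_mul, zpow_natCast, ← he', ← zpow_mul, mul_comm e]
    conv_rhs => rw [← zpow_one (a : G), ← huv, zpow_add, mul_comm u, zpow_mul, h1, one_zpow, one_mul]
  obtain ⟨l, hl⟩ := ha ⟨b * a * b⁻¹, hnorm.conj_mem _ a.2 b⟩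
  let _ := IsCyclic.commGroup (α := M)
  have hl' (x : M) : b * M.subtype x * b⁻¹ = M.subtype (x ^ l) := by
    obtain ⟨f, rfl⟩ := ha x
    have h1 : (a : G) ^ l = b * a * b⁻¹ := by simpa using congrArg Subtype.val hl
    simp only [Subgroup.coe_subtype, Subgroup.coe_zpow]
    rw [← zpow_mul, mul_comm, zpow_mul, h1, conj_zpow]
  -- As `b ^ p` centralizes `M`, `l ^ p ≡ 1` modulo `p ^ m`, and `l ^ p ≡ l` modulo `p`.
  have hlp : (p : ℤ) ∣ l - 1 := by
    have hconj (i : ℕ) : b ^ i * a * (b ^ i)⁻¹ = (a : G) ^ l ^ i := by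
      induction i with
      | zero => simp
      | succ i ih =>
        have := hl' (a ^ l ^ i)
        simp only [Subgroup.coe_subtype, Subgroup.coe_zpow, ← zpow_mul, ← pow_succ] at this
        rw [← this, ← ih, pow_succ']; group
    have h1 : a ^ l ^ p = a ^ (1 : ℤ) := by
      refine Subtype.ext ?_
      rw [Subgroup.coe_zpow, ← hconj, ← he', zpow_one,
        (Commute.zpow_self (a : G) _).eq, mul_inv_cancel_right]
    rw [zpow_eq_zpow_iff_modEq, hord] at h1
    have h2 : (p : ℤ) ∣ l ^ p - 1 :=
      (dvd_pow_self (p : ℤ) hm0).trans (by exact_mod_cast h1.symm.dvd)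
    rw [← ZMod.intCast_zmod_eq_zero_iff_dvd] at h2 ⊢
    simpa [ZMod.pow_card] using h2
  exact card_pow_le_of_dvd_exponentSum hp M.subtype M.subtype_injective ha hm hl' hlp
    (by simpa using he'.symm) hbij hw hg

end Coatom

theorem theoremA (p : ℕ) (hp : p.Prime) (G : Type*) [Group G] [Finite G] (hG : IsPGroup p G)
    (hmax : ∃ M : Subgroup G, IsCoatom M ∧ IsCyclic M)
    (k : ℕ) (w : FreeGroup (Fin k)) (g : G) (hg : g ∈ wordValues G w) :
    wordProb G w g ≥ 1 / (Nat.card G : ℚ) := by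
  obtain ⟨M, hM, _⟩ := hmax
  have key := FreeGroup.card_pow_le_of_isCyclic_isCoatom hp hG hM w hg
  have hpos : (0 : ℚ) < Nat.card G := by exact_mod_cast Nat.card_pos
  have hfib : (wordFibre G w g).ncard = Nat.card {x : Fin k → G // FreeGroup.lift x w = g} :=
    (Nat.card_coe_set_eq _).symm
  rw [wordProb, ge_iff_le, div_le_div_iff₀ hpos (pow_pos hpos k), one_mul, hfib]
  exact_mod_cast key
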